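/- Let $n\ge 0$. A multi-controlled NOT gate on $n$ wires has one target wire and a (possibly empty) set of control wires not containing the target, each control being labelled by a bit; it flips the target bit of $x\in\{0,1\}^n$ if $x$ agrees with the label on every control wire, and fixes $x$ otherwise. The wire mismatch of a finite product of such gates is the number of wires that are both a control wire of some gate in the product and the target of some gate in the product, where NOT gates (gates with no control) are not counted. The $n$-qubit Clifford hierarchy is $\mathcal{CH}=\bigcup_{k\ge 1}\mathcal{CH}_k$, where $\mathcal{CH}_1=\mathcal P_n$ is the $n$-qubit Pauli group, consisting of all $i^m\,\sigma_1\otimes\cdots\otimes\sigma_n$ with $m \in \mathbb{Z}$ and $\sigma_j\in\{I,X,Y,Z\}$, and, for $k\ge 2$, $$\mathcal{CH}_k=\{U \text{ a unitary } 2^n\times 2^n \text{ matrix} : UPU^\dagger\in\mathcal{CH}_{k-1}\text{ for all }P\in\mathcal P_n\}.$$ **Theorem.** Let $P$ be a permutation of $\{0,1\}^n$ that can be written as a finite product of multi-controlled NOT gates with wire mismatch at most $1$. Then the permutation gate $|x\rangle\mapsto|P(x)\rangle$ lies in $\mathcal{CH}$. -/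

import Mathlib

namespace Qubit

/-- Matrices on the state space of `n` qubits, whose computational basis is labelled by the bit
strings of length `n` (`false` is `0` and `true` is `1`). -/
abbrev Op (n : ℕ) : Type := Matrix (Fin n → Bool) (Fin n → Bool) ℂ

/-- The Pauli matrix `X`. -/
def pauliX : Matrix Bool Bool ℂ := Matrix.of fun a b => if a = b then 0 else 1

/-- The Pauli matrix `Z`. -/
def pauliZ : Matrix Bool Bool ℂ :=
  Matrix.of fun a b => if a = b then (if a = true then -1 else 1) else 0

/-- The Pauli matrix `Y`, with `Y 0 1 = -i` and `Y 1 0 = i`. -/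
noncomputable def pauliY : Matrix Bool Bool ℂ :=
  Matrix.of fun a b => if a = b then 0 else (if a = true then Complex.I else -Complex.I)

/-- The tensor (Kronecker) product of `n` one-qubit matrices. -/
def tensor {n : ℕ} (p : Fin n → Matrix Bool Bool ℂ) : Op n :=
  Matrix.of fun x y => ∏ i, p i (x i) (y i)

/-- The `n`-qubit Pauli group: tensor products of `I, X, Y, Z`, with phases `1, i, -1, -i`. -/
def pauliGroup (n : ℕ) : Set (Op n) :=
  {U | ∃ (m : ℕ) (p : Fin n → Matrix Bool Bool ℂ),
    (∀ i, p i = 1 ∨ p i = pauliX ∨ p i = pauliY ∨ p i = pauliZ) ∧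
    U = Complex.I ^ m • tensor p}

/-- The levels of the `n`-qubit Clifford hierarchy; they are numbered from `1`. -/
def cliffordLevel (n : ℕ) : ℕ → Set (Op n)
  | 0 => ∅
  | 1 => pauliGroup n
  | k + 2 => {U | U ∈ Matrix.unitaryGroup (Fin n → Bool) ℂ ∧
      ∀ P ∈ pauliGroup n, U * P * U.conjTranspose ∈ cliffordLevel n (k + 1)}

/-- The `n`-qubit Clifford hierarchy, the union of its levels. -/
def cliffordHierarchy (n : ℕ) : Set (Op n) :=
  {U | ∃ k : ℕ, 1 ≤ k ∧ U ∈ cliffordLevel n k}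

/-- The permutation gate `|x⟩ ↦ |P x⟩`. -/
def permGate {n : ℕ} (P : Equiv.Perm (Fin n → Bool)) : Op n :=
  Matrix.of fun y x => if y = P x then 1 else 0

/-- A multi-controlled NOT gate on `n` wires. On wire `i` there is no control if
`control i = none`, and a control which is on for the value `b` if `control i = some b`.
There may be no control at all (NOT gate). -/
structure MCNot (n : ℕ) where
  target : Fin n
  control : Fin n → Option Bool
  control_target : control target = none

namespace MCNot

variable {n : ℕ}

/-- The gate has a control on wire `i`. -/
def HasControlOn (g : MCNot n) (i : Fin n) : Prop := g.control i ≠ none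

/-- All controls of the gate are on for the bit string `x`. -/
def Fires (g : MCNot n) (x : Fin n → Bool) : Prop :=
  ∀ (i : Fin n) (b : Bool), g.control i = some b → x i = b

instance (g : MCNot n) (x : Fin n → Bool) : Decidable (g.Fires x) := by
  unfold Fires; infer_instance

/-- The action on bit strings: the target bit is flipped if all controls are on. -/
def act (g : MCNot n) (x : Fin n → Bool) : Fin n → Bool :=
  if g.Fires x then Function.update x g.target (!x g.target) else x

theorem act_involutive (g : MCNot n) : Function.Involutive g.act := by
  intro x
  by_cases h : g.Fires x
  · have h' : g.Fires (Function.update x g.target (!x g.target)) := by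
      intro i b hb
      have hi : i ≠ g.target := by
        rintro rfl
        simp [g.control_target] at hb
      rw [Function.update_of_ne hi]
      exact h i b hb
    simp [act, h, h']
  · simp [act, h]

/-- The permutation of bit strings performed by the gate. -/
def perm (g : MCNot n) : Equiv.Perm (Fin n → Bool) := g.act_involutive.toPerm

end MCNot

/-- The product of a finite sequence of multi-controlled NOT gates. -/
def circuitPerm {n : ℕ} (C : List (MCNot n)) : Equiv.Perm (Fin n → Bool) :=
  (C.map MCNot.perm).prod

/-- Wire `i` carries both a control and a target. Gates with no control are not counted. -/
def IsMismatched {n : ℕ} (C : List (MCNot n)) (i : Fin n) : Prop :=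
  (∃ g ∈ C, g.HasControlOn i) ∧ (∃ g ∈ C, g.target = i ∧ ∃ j, g.HasControlOn j)

/-- The wire mismatch: the number of wires that carry both controls and targets. -/
noncomputable def wireMismatch {n : ℕ} (C : List (MCNot n)) : ℕ :=
  Set.ncard {i : Fin n | IsMismatched C i}

end Qubit

/-! With mismatch at most 1, the wires can be ranked so that every control lies below its target.
The permutations triangular for this ranking form a finite 2-group containing all bit flips.
Extending it by diagonal matrices of fourth roots of unity gives a finite monomial 2-group, hence a
nilpotent group, which contains both the gate and the Paulis. Conjugating a Pauli by an element of
the group multiplies it by a commutator, one step further down the lower central series. Once the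
series is trivial, only a Pauli is left (`map_mem_cliffordHierarchy_of_isNilpotent`). -/

namespace Qubit

open scoped Matrix

/-! ### Triangular permutations and the ranking of wires -/

section Triangular

variable {n : ℕ}

/-- The permutations of bit strings which flip wire `i` depending only on the values of the wires
of rank less than the rank of `i`. -/
def triangularPerms (r : Fin n → ℕ) : Subgroup (Equiv.Perm (Fin n → Bool)) where
  carrier := {P | ∀ i x y, (∀ j, r j < r i → x j = y j) →
    (P x i ^^ x i) = (P y i ^^ y i)}
  one_mem' := by intro i x y _; simp
  mul_mem' := by
    intro P Q hP hQ i x y h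
    have h1 := hQ i x y h
    have h2 := hP i (Q x) (Q y) fun j hj => by
      have h3 := hQ j x y fun k hk => h k (hk.trans hj)
      rw [h j hj] at h3
      simpa using h3
    simp only [Equiv.Perm.mul_apply]
    revert h1 h2
    generalize P (Q x) i = a
    generalize P (Q y) i = b
    generalize Q x i = c
    generalize Q y i = d
    generalize x i = e
    generalize y i = f
    revert a b c d e f
    decide
  inv_mem' := by
    intro P hP i
    -- By induction on rank, the inverse images of `x` and `y` also agree on all wires below `i`.
    induction hk : r i using Nat.strong_induction_on generalizing i with
    | _ k ih =>
      subst hk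
      intro x y h
      have h1 := hP i (P⁻¹ x) (P⁻¹ y) fun j hj => by
        have h3 := ih (r j) hj j rfl x y fun k hk => h k (hk.trans hj)
        rw [h j hj] at h3
        simpa using h3
      simp only [← Equiv.Perm.mul_apply, mul_inv_cancel, Equiv.Perm.one_apply] at h1
      rw [Bool.xor_comm, h1, Bool.xor_comm]

theorem mem_triangularPerms {r : Fin n → ℕ} {P : Equiv.Perm (Fin n → Bool)} :
    P ∈ triangularPerms r ↔ ∀ i x y, (∀ j, r j < r i → x j = y j) →
      (P x i ^^ x i) = (P y i ^^ y i) := Iff.rfl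

/-- Once `Q = P ^ 2 ^ k` fixes all wires of rank below `k`, it flips a wire of rank `k` equally at
`x` and at `Q x`, so the flips cancel in `Q ^ 2`. -/
theorem triangularPerms_pow_apply {r : Fin n → ℕ} {P : Equiv.Perm (Fin n → Bool)}
    (hP : P ∈ triangularPerms r) (k : ℕ) (i : Fin n) (hi : r i < k) (x : Fin n → Bool) :
    (P ^ 2 ^ k) x i = x i := by
  induction k generalizing i x with
  | zero => omega
  | succ k ih =>
    have hQ := (triangularPerms r).pow_mem hP (2 ^ k)
    rw [pow_succ, mul_two, pow_add]
    generalize P ^ 2 ^ k = Q at ih hQ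
    rw [Equiv.Perm.mul_apply]
    have h := mem_triangularPerms.1 hQ i (Q x) x fun j hj => ih j (by omega) x
    revert h
    generalize Q (Q x) i = a
    generalize Q x i = b
    generalize x i = c
    revert a b c
    decide

theorem isPGroup_triangularPerms (r : Fin n → ℕ) : IsPGroup 2 (triangularPerms r) := by
  rintro ⟨P, hP⟩
  refine ⟨Finset.univ.sup r + 1, Subtype.ext (Equiv.ext fun x => funext fun i => ?_)⟩
  exact triangularPerms_pow_apply hP _ i
    (Nat.lt_succ_of_le (Finset.le_sup (Finset.mem_univ i))) x

/-- Flipping the wires on which `s` is on. -/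
def shiftPerm (s : Fin n → Bool) : Equiv.Perm (Fin n → Bool) :=
  Function.Involutive.toPerm (fun x i => x i ^^ s i) fun x => by ext i; simp

theorem shiftPerm_apply (s x : Fin n → Bool) (i : Fin n) : shiftPerm s x i = (x i ^^ s i) := rfl

theorem shiftPerm_mem_triangularPerms (r : Fin n → ℕ) (s : Fin n → Bool) :
    shiftPerm s ∈ triangularPerms r := by
  intro i x y _
  rw [shiftPerm_apply, shiftPerm_apply]
  cases x i <;> cases y i <;> cases s i <;> rfl

theorem MCNot.perm_mem_triangularPerms {r : Fin n → ℕ} (g : MCNot n)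
    (hg : ∀ j, g.HasControlOn j → r j < r g.target) : g.perm ∈ triangularPerms r := by
  intro i x y h
  change (g.act x i ^^ x i) = (g.act y i ^^ y i)
  by_cases hi : i = g.target
  · subst hi
    have hf : g.Fires x ↔ g.Fires y := by
      refine forall_congr' fun j => forall_congr' fun b => ?_
      refine imp_congr_right fun hb => ?_
      rw [h j (hg j (by simp [HasControlOn, hb]))]
    by_cases hx : g.Fires x
    · simp [act, hx, hf.1 hx]
    · simp [act, hx, mt hf.2 hx]
  · have h' : ∀ z, g.act z i = z i := by
      intro z
      unfold act
      split_ifs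
      · exact Function.update_of_ne hi _ _
      · rfl
    simp [h']

theorem circuitPerm_mem_triangularPerms {r : Fin n → ℕ} (C : List (MCNot n))
    (hC : ∀ g ∈ C, ∀ j, g.HasControlOn j → r j < r g.target) :
    circuitPerm C ∈ triangularPerms r := by
  refine Subgroup.list_prod_mem _ fun P hP => ?_
  obtain ⟨g, hg, rfl⟩ := List.mem_map.1 hP
  exact g.perm_mem_triangularPerms (hC g hg)

open Classical in
/-- If at most one wire is mismatched, the wires can be ranked so that the controls of each gate
have lower rank than its target. -/
theorem exists_rank_of_wireMismatch_le_one (C : List (MCNot n)) (hC : wireMismatch C ≤ 1) :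
    ∃ r : Fin n → ℕ, ∀ g ∈ C, ∀ j, g.HasControlOn j → r j < r g.target := by
  have hsub := (Set.ncard_le_one (Set.toFinite _)).1 hC
  -- Rank 1 is the mismatched wire, 2 the wires that are only targets, 0 the rest. A control and its
  -- target cannot both have rank 1, since they would be the same wire.
  refine ⟨fun i => if ∃ g ∈ C, g.target = i ∧ ∃ j, g.HasControlOn j then
    (if ∃ g ∈ C, g.HasControlOn i then 1 else 2) else 0, fun g hg j hj => ?_⟩
  have hc : ∃ g ∈ C, g.HasControlOn j := ⟨g, hg, hj⟩
  have ht : ∃ h ∈ C, h.target = g.target ∧ ∃ j, h.HasControlOn j := ⟨g, hg, rfl, j, hj⟩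
  simp only [hc, ht, if_true]
  by_cases h1 : ∃ h ∈ C, h.target = j ∧ ∃ j, h.HasControlOn j
  · by_cases h2 : ∃ h ∈ C, h.HasControlOn g.target
    · have := hsub j ⟨hc, h1⟩ g.target ⟨h2, ht⟩
      subst this
      exact absurd g.control_target hj
    · simp [h1, h2]
  · rw [if_neg h1]
    split_ifs <;> norm_num

end Triangular

/-! ### The monomial 2-group -/

section Monomial

variable {n : ℕ}

/-- The group of the monomial matrices whose nonzero entries are fourth roots of unity and whose
underlying permutation lies in `T`. -/
abbrev MonomialGroup (T : Subgroup (Equiv.Perm (Fin n → Bool))) : Type :=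
  ((Fin n → Bool) → rootsOfUnity 4 ℂ) ⋊[mulAutArrow] T

theorem isPGroup_monomialGroup {T : Subgroup (Equiv.Perm (Fin n → Bool))} (hT : IsPGroup 2 T) :
    IsPGroup 2 (MonomialGroup T) := by
  obtain ⟨k, hk⟩ := IsPGroup.iff_card.1 hT
  refine IsPGroup.of_card (n := 2 * 2 ^ n + k) ?_
  have h4 : Nat.card (rootsOfUnity 4 ℂ) = 2 ^ 2 := by
    rw [Complex.card_rootsOfUnity]; rfl
  rw [SemidirectProduct.card, hk, Nat.card_fun, h4, pow_add, pow_mul]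
  simp

instance (T : Subgroup (Equiv.Perm (Fin n → Bool))) : Finite (MonomialGroup T) :=
  Finite.of_equiv _ SemidirectProduct.equivProd.symm

/-- The matrix of an element of the monomial group. -/
noncomputable def monomialMatrix (T : Subgroup (Equiv.Perm (Fin n → Bool))) :
    MonomialGroup T →* Op n where
  -- Phases are indexed by the output `y`, matching the action `f ↦ f ∘ P⁻¹` of `mulAutArrow`.
  toFun g := Matrix.of fun y x => if y = g.right.1 x then ((g.left y : ℂˣ) : ℂ) else 0
  map_one' := by
    ext y x
    rw [Matrix.one_apply]
    exact if_congr Iff.rfl (by simp) rfl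
  map_mul' g h := by
    ext y x
    rw [Matrix.mul_apply, Finset.sum_eq_single (h.right.1 x)]
    · by_cases hy : y = g.right.1 (h.right.1 x)
      · subst hy
        have : (mulAutArrow g.right h.left) (g.right.1 (h.right.1 x)) = h.left (h.right.1 x) := by
          change h.left (g.right.1⁻¹ (g.right.1 (h.right.1 x))) = _
          simp
        simp only [Matrix.of_apply, SemidirectProduct.mul_left, SemidirectProduct.mul_right,
          Subgroup.coe_mul, Equiv.Perm.mul_apply, if_true, Pi.mul_apply, Subgroup.coe_mul,
          Units.val_mul]
        rw [this]
      · simp [hy]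
    · intro z _ hz
      simp [hz]
    · simp

theorem monomialMatrix_apply {T : Subgroup (Equiv.Perm (Fin n → Bool))} (g : MonomialGroup T)
    (y x : Fin n → Bool) :
    monomialMatrix T g y x = if y = g.right.1 x then ((g.left y : ℂˣ) : ℂ) else 0 := rfl

theorem conjTranspose_monomialMatrix {T : Subgroup (Equiv.Perm (Fin n → Bool))}
    (g : MonomialGroup T) : (monomialMatrix T g)ᴴ = monomialMatrix T g⁻¹ := by
  have h1 : (monomialMatrix T g)ᴴ * monomialMatrix T g = 1 := by
    ext x y
    rw [Matrix.mul_apply, Finset.sum_eq_single (g.right.1 y)]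
    · have hu : star ((g.left (g.right.1 y) : ℂˣ) : ℂ) * ((g.left (g.right.1 y) : ℂˣ) : ℂ) = 1 := by
        have h4 : ((g.left (g.right.1 y) : ℂˣ) : ℂ) ^ 4 = 1 :=
          (mem_rootsOfUnity' _ _).1 (g.left (g.right.1 y)).2
        have hn := Complex.norm_eq_one_of_pow_eq_one h4 (by norm_num)
        rw [Complex.star_def, mul_comm, Complex.mul_conj, Complex.normSq_eq_norm_sq, hn]
        simp
      by_cases hxy : x = y
      · subst hxy
        simp only [Matrix.conjTranspose_apply, monomialMatrix_apply, if_true, Matrix.one_apply_eq]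
        exact hu
      · have : g.right.1 y ≠ g.right.1 x := fun h => hxy (g.right.1.injective h).symm
        simp [monomialMatrix_apply, hxy, this]
    · intro z _ hz
      simp [monomialMatrix_apply, hz]
    · simp
  calc (monomialMatrix T g)ᴴ
      = (monomialMatrix T g)ᴴ * (monomialMatrix T g * monomialMatrix T g⁻¹) := by
        rw [← map_mul, mul_inv_cancel, map_one, mul_one]
    _ = monomialMatrix T g⁻¹ := by rw [← mul_assoc, h1, one_mul]

theorem monomialMatrix_inr {T : Subgroup (Equiv.Perm (Fin n → Bool))} (P : T) :
    monomialMatrix T (SemidirectProduct.inr P) = permGate P.1 := by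
  ext y x
  simp only [monomialMatrix_apply, permGate, Matrix.of_apply]
  exact if_congr Iff.rfl (by simp) rfl

end Monomial

/-! ### Pauli matrices -/

section Pauli

variable {n : ℕ}

/-- A one-qubit Pauli matrix is monomial, and its nonzero entries are fourth roots of unity. -/
theorem exists_eq_monomial_of_pauli {p : Matrix Bool Bool ℂ}
    (hp : p = 1 ∨ p = pauliX ∨ p = pauliY ∨ p = pauliZ) :
    ∃ (s : Bool) (f : Bool → ℂ), (∀ a, f a ^ 4 = 1) ∧
      ∀ a b, p a b = if a = (b ^^ s) then f a else 0 := by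
  rcases hp with rfl | rfl | rfl | rfl
  · exact ⟨false, fun _ => 1, by simp, by simp [Matrix.one_apply]⟩
  · exact ⟨true, fun _ => 1, by simp, by simp [pauliX]⟩
  · exact ⟨true, fun a => if a then Complex.I else -Complex.I,
      by simp [Even.neg_pow (by decide : Even 4)], by simp [pauliY]⟩
  · exact ⟨false, fun a => if a then -1 else 1, by simp; norm_num, by simp [pauliZ]⟩

theorem exists_monomialMatrix_eq_of_mem_pauliGroup {T : Subgroup (Equiv.Perm (Fin n → Bool))}
    (hT : ∀ s, shiftPerm s ∈ T) {Q : Op n} (hQ : Q ∈ pauliGroup n) :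
    ∃ g, monomialMatrix T g = Q := by
  obtain ⟨m, p, hp, rfl⟩ := hQ
  choose s f hf hpf using fun i => exists_eq_monomial_of_pauli (hp i)
  have h4 : ∀ y : Fin n → Bool, (Complex.I ^ m * ∏ i, f i (y i)) ^ 4 = 1 := by
    intro y
    rw [mul_pow, ← pow_mul, mul_comm m, pow_mul, Complex.I_pow_four, one_pow,
      ← Finset.prod_pow, Finset.prod_congr rfl fun i _ => hf i (y i)]
    simp
  refine ⟨⟨fun y => rootsOfUnity.mkOfPowEq _ (h4 y), ⟨shiftPerm s, hT s⟩⟩, ?_⟩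
  ext y x
  simp only [monomialMatrix_apply, Matrix.smul_apply, tensor, Matrix.of_apply, hpf,
    rootsOfUnity.coe_mkOfPowEq, smul_eq_mul]
  by_cases h : y = shiftPerm s x
  · rw [if_pos h]
    congr 1
    refine Finset.prod_congr rfl fun i _ => ?_
    rw [if_pos (by rw [h, shiftPerm_apply])]
  · rw [if_neg h]
    obtain ⟨i, hi⟩ := Function.ne_iff.1 h
    rw [Finset.prod_eq_zero (Finset.mem_univ i), mul_zero]
    exact if_neg hi

theorem tensor_mul (p q : Fin n → Matrix Bool Bool ℂ) :
    tensor p * tensor q = tensor fun i => p i * q i := by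
  ext x y
  simp only [tensor, Matrix.mul_apply, Matrix.of_apply, ← Finset.prod_mul_distrib]
  rw [Finset.prod_univ_sum, Fintype.piFinset_univ]

theorem conjTranspose_tensor (p : Fin n → Matrix Bool Bool ℂ) :
    (tensor p)ᴴ = tensor fun i => (p i)ᴴ := by
  ext x y
  simp [tensor, Matrix.conjTranspose_apply]

theorem tensor_smul (c : Fin n → ℂ) (p : Fin n → Matrix Bool Bool ℂ) :
    (tensor fun i => c i • p i) = (∏ i, c i) • tensor p := by
  ext x y
  simp [tensor, Finset.prod_mul_distrib]

/-- One-qubit Paulis commute or anticommute, so `m` is 0 or 2. -/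
theorem exists_pauli_conj_eq {p q : Matrix Bool Bool ℂ}
    (hp : p = 1 ∨ p = pauliX ∨ p = pauliY ∨ p = pauliZ)
    (hq : q = 1 ∨ q = pauliX ∨ q = pauliY ∨ q = pauliZ) :
    ∃ m : ℕ, p * q * pᴴ = Complex.I ^ m • q := by
  have key : p * q * pᴴ = q ∨ p * q * pᴴ = -q := by
    rcases hp with rfl | rfl | rfl | rfl <;> rcases hq with rfl | rfl | rfl | rfl <;>
      first
      | (left; ext a b; cases a <;> cases b <;>
          simp [Matrix.mul_apply, pauliX, pauliY, pauliZ]; done)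
      | (right; ext a b; cases a <;> cases b <;>
          simp [Matrix.mul_apply, pauliX, pauliY, pauliZ])
  rcases key with h | h
  · exact ⟨0, by simpa using h⟩
  · exact ⟨2, by simpa using h⟩

theorem conj_mem_pauliGroup {P Q : Op n} (hP : P ∈ pauliGroup n) (hQ : Q ∈ pauliGroup n) :
    P * Q * Pᴴ ∈ pauliGroup n := by
  obtain ⟨k, p, hp, rfl⟩ := hP
  obtain ⟨m, q, hq, rfl⟩ := hQ
  choose e he using fun i => exists_pauli_conj_eq (hp i) (hq i)
  refine ⟨m + ∑ i, e i, q, hq, ?_⟩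
  have hk : Complex.I ^ k * star (Complex.I ^ k) = 1 := by
    rw [star_pow, ← mul_pow, Complex.star_def, Complex.conj_I]
    simp
  rw [Matrix.conjTranspose_smul, conjTranspose_tensor, smul_mul_smul_comm, smul_mul_smul_comm,
    tensor_mul, tensor_mul, funext he, tensor_smul, Finset.prod_pow_eq_pow_sum, smul_smul]
  congr 1
  rw [pow_add]
  linear_combination (Complex.I ^ m * Complex.I ^ (∑ i, e i)) * hk

theorem one_mem_pauliGroup : (1 : Op n) ∈ pauliGroup n := by
  refine ⟨0, fun _ => 1, fun _ => Or.inl rfl, ?_⟩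
  ext x y
  simp only [tensor, Matrix.one_apply, pow_zero, one_smul, Matrix.of_apply, Finset.prod_boole,
    Finset.mem_univ, forall_const, funext_iff]

end Pauli

/-- A unitary representation of a nilpotent group whose image contains the Pauli group has its
image in the Clifford hierarchy. -/
theorem map_mem_cliffordHierarchy_of_isNilpotent {n : ℕ} {G : Type*} [Group G]
    [Group.IsNilpotent G] (ρ : G →* Op n) (hstar : ∀ g, (ρ g)ᴴ = ρ g⁻¹)
    (hpauli : ∀ Q ∈ pauliGroup n, ∃ g, ρ g = Q) (g : G) : ρ g ∈ cliffordHierarchy n := by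
  have hunit : ∀ g, ρ g ∈ Matrix.unitaryGroup (Fin n → Bool) ℂ := fun g => by
    rw [Matrix.mem_unitaryGroup_iff, Matrix.star_eq_conjTranspose, hstar, ← map_mul,
      mul_inv_cancel, map_one]
  obtain ⟨c, hc⟩ := Subgroup.nilpotent_iff_lowerCentralSeries.1 ‹Group.IsNilpotent G›
  -- The Pauli factor `s` is carried along because a conjugate of a Pauli need not lie deep in the
  -- series; only its commutator part `t` descends.
  have key : ∀ k j, j + k = c → ∀ s t : G, ρ s ∈ pauliGroup n →
      t ∈ Subgroup.lowerCentralSeries (⊤ : Subgroup G) j → ρ (s * t) ∈ cliffordLevel n (k + 1) := by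
    intro k
    induction k with
    | zero =>
      rintro j rfl s t hs ht
      rw [add_zero] at hc
      rw [hc, Subgroup.mem_bot] at ht
      rw [ht, mul_one]
      exact hs
    | succ k ih =>
      intro j hj s t hs ht
      refine ⟨hunit _, fun Q hQ => ?_⟩
      obtain ⟨q, rfl⟩ := hpauli Q hQ
      -- `(st)q(st)⁻¹ = (sqs⁻¹) · s[q⁻¹, t]s⁻¹`: a Pauli times an element of the next term.
      have h := ih (j + 1) (by omega) (s * q * s⁻¹) (s * (q⁻¹ * t * q * t⁻¹) * s⁻¹)
        (by rw [map_mul, map_mul, ← hstar]; exact conj_mem_pauliGroup hs hQ)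
        (Subgroup.Normal.conj_mem (H := Subgroup.lowerCentralSeries ⊤ (j + 1)) inferInstance _ (by
          rw [Subgroup.lowerCentralSeries_succ, Subgroup.commutator_comm]
          simpa [commutatorElement_def] using
            Subgroup.commutator_mem_commutator (Subgroup.mem_top q⁻¹) ht) _)
      rw [hstar, ← map_mul, ← map_mul]
      convert h using 2
      group
  exact ⟨c + 1, by omega, by
    simpa using key c 0 (by omega) 1 g (by rw [map_one]; exact one_mem_pauliGroup) (by simp)⟩

end Qubit

theorem mainTheorem4 (n : ℕ) (P : Equiv.Perm (Fin n → Bool))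
    (hP : ∃ C : List (Qubit.MCNot n), Qubit.circuitPerm C = P ∧ Qubit.wireMismatch C ≤ 1) :
    Qubit.permGate P ∈ Qubit.cliffordHierarchy n := by
  obtain ⟨C, rfl, hC⟩ := hP
  obtain ⟨r, hr⟩ := Qubit.exists_rank_of_wireMismatch_le_one C hC
  have hT := Qubit.isPGroup_monomialGroup (Qubit.isPGroup_triangularPerms r)
  have := hT.isNilpotent
  rw [← Qubit.monomialMatrix_inr (T := Qubit.triangularPerms r)
    ⟨_, Qubit.circuitPerm_mem_triangularPerms C hr⟩]
  exact Qubit.map_mem_cliffordHierarchy_of_isNilpotent _ Qubit.conjTranspose_monomialMatrix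
    (fun _ hQ => Qubit.exists_monomialMatrix_eq_of_mem_pauliGroup
      (Qubit.shiftPerm_mem_triangularPerms r) hQ) _
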